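/- All graphs are finite, undirected and simple. Let $G=(V,E)$ be a graph, $\delta(v)\subseteq E$ the set of edges incident to $v\in V$, and $f\colon V\to\{0,1,2,3\}$ a map. A \emph{connected mod-4 $f$-factor} of $G$ is a vector $x\in\{0,1,2,3\}^E$ such that $\sum_{e\in\delta(v)}x_e\equiv f(v)\pmod 4$ for every $v\in V$ and the spanning subgraph $(V,\{e\in E : x_e>0\})$ is connected. The graph $G$ is \emph{all-round} if it has a connected mod-4 $f$-factor for every $f\colon V\to\{0,1,2,3\}$ with $\sum_{v\in V}f(v)$ even. A bipartite graph $G$ with colour classes $A,B$ is \emph{bipartite all-round} if it has a connected mod-4 $f$-factor for every $f\colon V\to\{0,1,2,3\}$ with $\sum_{v\in A}f(v)\equiv\sum_{v\in B}f(v)\pmod 4$. Let $G=(V,E)$ be a connected graph. (i) If $|V|\ge 3$ and the minimum degree of $G$ is at least $|V|/2$, then $G$ is all-round if it is not bipartite, and bipartite all-round if it is bipartite. (ii) If $|V|\ge 4$, the minimum degree of $G$ is at least $|V|/3$, and $G$ is not isomorphic to the 5-cycle $C_5$, then $G$ is all-round if it is not bipartite, and bipartite all-round if it is bipartite. -/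

import Mathlib

/-- For `x ∈ {0,1,2,3}^E`, the spanning subgraph of `G` whose edges are the `e` with `x e > 0`.
The multigraph `(G, x)` is connected when this simple graph on the whole vertex set is. -/
def supportGraph {V : Type*} (G : SimpleGraph V) (x : G.edgeSet → Fin 4) : SimpleGraph V :=
  SimpleGraph.fromEdgeSet {e : Sym2 V | ∃ h : e ∈ G.edgeSet, 0 < x ⟨e, h⟩}

open Classical in
/-- `x ∈ {0,1,2,3}^E` is a mod-4 `f`-factor of `G`: at every vertex `v`, the sum of `x e` over the
edges `e` incident to `v` is congruent to `f v` modulo 4. -/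
def IsModFourFactor {V : Type*} [Fintype V] (G : SimpleGraph V) (f : V → Fin 4)
    (x : G.edgeSet → Fin 4) : Prop :=
  ∀ v : V, (∑ e : G.edgeSet with v ∈ e.1, (x e : ℕ)) ≡ (f v : ℕ) [MOD 4]

/-- `G` has a connected mod-4 `f`-factor. -/
def HasConnectedModFourFactor {V : Type*} [Fintype V] (G : SimpleGraph V) (f : V → Fin 4) : Prop :=
  ∃ x : G.edgeSet → Fin 4, IsModFourFactor G f x ∧ (supportGraph G x).Connected

/-- `G` is all-round: it has a connected mod-4 `f`-factor for every `f : V → {0,1,2,3}` whose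
values have an even sum. -/
def IsAllRound {V : Type*} [Fintype V] (G : SimpleGraph V) : Prop :=
  ∀ f : V → Fin 4, Even (∑ v : V, (f v : ℕ)) → HasConnectedModFourFactor G f

open Classical in
/-- `G` is bipartite all-round: it is bipartite, and for every bipartition of its vertex set into
`U` and the complement of `U` (unique up to swapping when `G` is connected) and every
`f : V → {0,1,2,3}` whose sums over the two sides are congruent modulo 4, it has a connected
mod-4 `f`-factor. -/
def IsBipartiteAllRound {V : Type*} [Fintype V] (G : SimpleGraph V) : Prop :=
  G.IsBipartite ∧
    ∀ U : Finset V, G.IsBipartiteWith (U : Set V) ((Uᶜ : Finset V) : Set V) →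
      ∀ f : V → Fin 4, (∑ v ∈ U, (f v : ℕ)) ≡ (∑ v ∈ Uᶜ, (f v : ℕ)) [MOD 4] →
        HasConnectedModFourFactor G f

/-! Call a vertex set flexible if it carries a connected factor for every demand orthogonal to `c`,
where `c` is `±1` by colour class or constantly `2`; the goal is that `univ` is flexible.
Prescribing the demands inside an ear leaves only its first weight free, and every edge weight is
then a bijective function of that choice. Four choices and at most seven edges leave one choice with
at most one zero weight, which does not disconnect anything: flexible sets absorb ears of length at
most 7 (`Flexible.addEar`).

A maximal flexible set `S` thus has only long ears. If a component of `G - S` had two edges to `S`,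
a shortest path between their outer ends would have length at least 6, and three disjoint
neighbourhoods along it would fill more than `|V| - |S|` vertices (`NoShortEar.unique_edge`). So a
single bridge leaves the component.

In the bipartite case both sides of a bridge have at least `2δ` vertices, which is impossible.
Otherwise one starts from a triangle, or from a pentagon with an outside vertex adjacent to two of
its vertices (`exists_flexible_start`). The far side of a bridge has fewer than `2δ` vertices and is
itself flexible (`IsBridged.flexible`), so `Flexible.bridge` contradicts maximality. -/

namespace ModFour

set_option linter.unusedSectionVars false

open Finset

variable {V : Type*} [Fintype V] [DecidableEq V] {G : SimpleGraph V}

/-! ### Ears and the extension of connected factors -/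

section

/-- The graph of the edges with nonzero weight. -/
def weightGraph (X : Sym2 V → ZMod 4) : SimpleGraph V :=
  SimpleGraph.fromEdgeSet {e | X e ≠ 0}

/-- `X` is supported on the edges of `G[S]`, its support is connected on `S`, and it meets the
demand `f` modulo 4 at every vertex of `S`. -/
structure IsConnectedFactorOn (G : SimpleGraph V) (S : Finset V) (f : V → ZMod 4)
    (X : Sym2 V → ZMod 4) : Prop where
  mem_edgeSet : ∀ e, X e ≠ 0 → e ∈ G.edgeSet
  mem_of_mem : ∀ e, X e ≠ 0 → ∀ v ∈ e, v ∈ S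
  sum_eq : ∀ v ∈ S, ∑ e with v ∈ e, X e = f v
  reachable : ∀ u ∈ S, ∀ v ∈ S, (weightGraph X).Reachable u v

/-- `S` carries a connected factor for every demand orthogonal to `c`. For `c = ±1` according to
the side of a bipartition this is bipartite all-roundness, for `c = 2` it is all-roundness. -/
def Flexible (G : SimpleGraph V) (S : Finset V) (c : V → ZMod 4) : Prop :=
  ∀ f : V → ZMod 4, ∑ v ∈ S, c v * f v = 0 → ∃ X, IsConnectedFactorOn G S f X

/-- `p 0, …, p m` is an ear of `S`: a path, or a cycle through `p 0 = p m`, with exactly the ends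
in `S`. -/
structure IsEar (G : SimpleGraph V) (S : Finset V) (p : ℕ → V) (m : ℕ) : Prop where
  two_le : 2 ≤ m
  three_le : p 0 = p m → 3 ≤ m
  fst_mem : p 0 ∈ S
  lst_mem : p m ∈ S
  inner : ∀ i, 0 < i → i < m → p i ∉ S
  inj : ∀ i j, 0 < i → i < m → 0 < j → j < m → p i = p j → i = j
  adj : ∀ i < m, G.Adj (p i) (p (i + 1))

/-- The vertex set obtained from `S` by adding the inner vertices of an ear. -/
def addEar (S : Finset V) (p : ℕ → V) (m : ℕ) : Finset V := S ∪ (Ico 1 m).image p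

/-- The weights `x` placed on the edges of a vertex sequence. -/
def pathWeight (p : ℕ → V) (m : ℕ) (x : ℕ → ZMod 4) (e : Sym2 V) : ZMod 4 :=
  ∑ i ∈ range m, if e = s(p i, p (i + 1)) then x i else 0

theorem weightGraph_adj {X : Sym2 V → ZMod 4} {u v : V} :
    (weightGraph X).Adj u v ↔ X s(u, v) ≠ 0 ∧ u ≠ v := by
  simp [weightGraph]

theorem sum_pathWeight (p : ℕ → V) (m : ℕ) (x : ℕ → ZMod 4) (v : V) :
    ∑ e with v ∈ e, pathWeight p m x e =
      ∑ i ∈ range m, if v = p i ∨ v = p (i + 1) then x i else 0 := by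
  simp only [pathWeight]
  rw [sum_comm]
  refine sum_congr rfl fun i _ => ?_
  rw [sum_ite_eq']
  simp

theorem IsEar.eq_of_eq {S : Finset V} {p : ℕ → V} {m : ℕ} (h : IsEar G S p m) {a b : ℕ}
    (ha : a ≤ m) (hb : b ≤ m) (hab : p a = p b) : a = b ∨ (a = 0 ∧ b = m) ∨ (a = m ∧ b = 0) := by
  by_cases ha' : 0 < a ∧ a < m <;> by_cases hb' : 0 < b ∧ b < m
  · exact .inl (h.inj a b ha'.1 ha'.2 hb'.1 hb'.2 hab)
  · have h1 := h.inner a ha'.1 ha'.2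
    rcases (by omega : b = 0 ∨ b = m) with rfl | rfl
    · exact absurd (hab ▸ h.fst_mem) h1
    · exact absurd (hab ▸ h.lst_mem) h1
  · have h1 := h.inner b hb'.1 hb'.2
    rcases (by omega : a = 0 ∨ a = m) with rfl | rfl
    · exact absurd (hab ▸ h.fst_mem) h1
    · exact absurd (hab ▸ h.lst_mem) h1
  · omega

/-- An edge traversed twice in opposite directions would force a closed ear with two edges, which
`three_le` excludes. -/
theorem IsEar.edge_inj {S : Finset V} {p : ℕ → V} {m : ℕ} (h : IsEar G S p m) {i j : ℕ}
    (hi : i < m) (hj : j < m) (hij : s(p i, p (i + 1)) = s(p j, p (j + 1))) : i = j := by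
  have h3 := h.three_le
  have h2 := h.two_le
  rcases Sym2.eq_iff.1 hij with ⟨h1, -⟩ | ⟨h1, h4⟩
  · rcases h.eq_of_eq hi.le hj.le h1 with h | h | h <;> omega
  · rcases h.eq_of_eq hi.le (show j + 1 ≤ m from hj) h1 with h5 | h5 | h5 <;>
      rcases h.eq_of_eq (show i + 1 ≤ m from hi) hj.le h4 with h6 | h6 | h6 <;> try omega
    · obtain ⟨h6, rfl⟩ := h6
      rw [h6] at h4
      have := h3 h4.symm
      omega
    · obtain ⟨rfl, h5⟩ := h5
      rw [h5] at h1
      have := h3 h1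
      omega

theorem IsEar.pathWeight_edge {S : Finset V} {p : ℕ → V} {m : ℕ} (h : IsEar G S p m)
    (x : ℕ → ZMod 4) {j : ℕ} (hj : j < m) : pathWeight p m x s(p j, p (j + 1)) = x j := by
  rw [pathWeight, sum_eq_single_of_mem j (mem_range.2 hj), if_pos rfl]
  intro i hi hij
  rw [if_neg]
  intro h'
  exact hij (h.edge_inj (mem_range.1 hi) hj h'.symm)

theorem exists_of_pathWeight_ne_zero {p : ℕ → V} {m : ℕ} {x : ℕ → ZMod 4} {e : Sym2 V}
    (h : pathWeight p m x e ≠ 0) : ∃ i < m, e = s(p i, p (i + 1)) := by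
  obtain ⟨i, hi, h⟩ := exists_ne_zero_of_sum_ne_zero h
  refine ⟨i, mem_range.1 hi, ?_⟩
  by_contra h'
  exact h (if_neg h')

theorem IsEar.not_mem_edge {S : Finset V} {p : ℕ → V} {m : ℕ} (h : IsEar G S p m) {i : ℕ}
    (hi : i < m) : ∃ v ∈ s(p i, p (i + 1)), v ∉ S := by
  have := h.two_le
  by_cases h0 : 0 < i
  · exact ⟨p i, by simp, h.inner i h0 hi⟩
  · exact ⟨p (i + 1), by simp, h.inner _ (by omega) (by omega)⟩

theorem IsEar.mem_addEar {S : Finset V} {p : ℕ → V} {m : ℕ} (h : IsEar G S p m) {i : ℕ}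
    (hi : i ≤ m) : p i ∈ addEar S p m := by
  rw [addEar, mem_union]
  by_cases h' : 0 < i ∧ i < m
  · exact .inr (mem_image_of_mem _ (mem_Ico.2 h'))
  · rcases (by omega : i = 0 ∨ i = m) with rfl | rfl
    · exact .inl h.fst_mem
    · exact .inl h.lst_mem

/-- A connected factor of `S` extends along an ear on which at most one weight vanishes. -/
theorem IsEar.isConnectedFactorOn {S : Finset V} {p : ℕ → V} {m : ℕ} (h : IsEar G S p m)
    {x : ℕ → ZMod 4} (hx : ∀ i < m, ∀ j < m, x i = 0 → x j = 0 → i = j) {f : V → ZMod 4}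
    (hf : ∀ i, 0 < i → i < m → f (p i) = x (i - 1) + x i) {X : Sym2 V → ZMod 4}
    (hX : IsConnectedFactorOn G S (fun v => f v - ((if v = p 0 then x 0 else 0) +
      (if v = p m then x (m - 1) else 0))) X) :
    IsConnectedFactorOn G (addEar S p m) f (fun e => X e + pathWeight p m x e) := by
  have h2 := h.two_le
  -- Every ear edge has an end outside `S`, so old and new weights have disjoint supports and cannot
  -- cancel.
  have hXY : ∀ i < m, X s(p i, p (i + 1)) = 0 := by
    intro i hi
    obtain ⟨v, hv, hvS⟩ := h.not_mem_edge hi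
    by_contra h0
    exact hvS (hX.mem_of_mem _ h0 v hv)
  have hYX : ∀ e, X e ≠ 0 → pathWeight p m x e = 0 := by
    intro e he
    by_contra h0
    obtain ⟨i, hi, rfl⟩ := exists_of_pathWeight_ne_zero h0
    exact he (hXY i hi)
  have hor : ∀ e, X e + pathWeight p m x e ≠ 0 → X e ≠ 0 ∨ ∃ i < m, e = s(p i, p (i + 1)) := by
    intro e he
    by_cases h0 : X e = 0
    · rw [h0, zero_add] at he
      exact .inr (exists_of_pathWeight_ne_zero he)
    · exact .inl h0
  have hmono : weightGraph X ≤ weightGraph (fun e => X e + pathWeight p m x e) := by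
    intro u v huv
    rw [weightGraph_adj] at huv ⊢
    refine ⟨?_, huv.2⟩
    rw [hYX _ huv.1, add_zero]
    exact huv.1
  have hstep : ∀ i < m, x i ≠ 0 →
      (weightGraph (fun e => X e + pathWeight p m x e)).Reachable (p i) (p (i + 1)) := by
    intro i hi hxi
    refine SimpleGraph.Adj.reachable (weightGraph_adj.2 ⟨?_, (h.adj i hi).ne⟩)
    rwa [hXY i hi, h.pathWeight_edge x hi, zero_add]
  refine ⟨fun e he => ?_, fun e he v hv => ?_, fun v hv => ?_, ?_⟩
  · rcases hor e he with he | ⟨i, hi, rfl⟩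
    · exact hX.mem_edgeSet e he
    · exact h.adj i hi
  · rcases hor e he with he | ⟨i, hi, rfl⟩
    · exact mem_union_left _ (hX.mem_of_mem e he v hv)
    · rcases Sym2.mem_iff.1 hv with rfl | rfl
      · exact h.mem_addEar hi.le
      · exact h.mem_addEar hi
  · rw [sum_add_distrib, sum_pathWeight]
    by_cases hvS : v ∈ S
    · rw [hX.sum_eq v hvS, sub_add_eq_add_sub, sub_eq_iff_eq_add, add_right_inj]
      have : ∀ i ∈ range m, (if v = p i ∨ v = p (i + 1) then x i else 0) =
          (if i = 0 then (if v = p 0 then x 0 else 0) else 0) +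
          (if i = m - 1 then (if v = p m then x (m - 1) else 0) else 0) := by
        intro i hi
        rw [mem_range] at hi
        have h1 : 0 < i → v ≠ p i := by
          rintro h1 rfl
          exact h.inner i h1 hi hvS
        have h3 : i + 1 < m → v ≠ p (i + 1) := by
          rintro h3 rfl
          exact h.inner _ (by omega) h3 hvS
        by_cases hi0 : i = 0
        · subst hi0
          have : (0 : ℕ) ≠ m - 1 := by omega
          simp [this, h3 (by omega)]
        · by_cases him : i = m - 1
          · have : i + 1 = m := by omega
            rw [← him, if_neg hi0, if_pos rfl, this, zero_add]
            simp [h1 (by omega)]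
          · simp [hi0, him, h1 (by omega), h3 (by omega)]
      rw [sum_congr rfl this, sum_add_distrib, sum_ite_eq', sum_ite_eq',
        if_pos (mem_range.2 (by omega)), if_pos (mem_range.2 (by omega))]
    · rw [addEar, mem_union] at hv
      obtain ⟨j, hj, rfl⟩ := mem_image.1 (hv.resolve_left hvS)
      rw [mem_Ico] at hj
      rw [sum_eq_zero, zero_add, hf j (by omega) hj.2]
      · have : ∀ i ∈ range m, (if p j = p i ∨ p j = p (i + 1) then x i else 0) =
            (if i = j - 1 then x i else 0) + (if i = j then x i else 0) := by
          intro i hi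
          rw [mem_range] at hi
          have h1 : p j = p i ↔ i = j :=
            ⟨fun h' => by rcases h.eq_of_eq hj.2.le hi.le h' with h' | h' | h' <;> omega,
              fun h' => by rw [h']⟩
          have h3 : p j = p (i + 1) ↔ i = j - 1 :=
            ⟨fun h' => by
              rcases h.eq_of_eq hj.2.le (show i + 1 ≤ m from hi) h' with h' | h' | h' <;> omega,
              fun h' => by rw [h']; congr 1; omega⟩
          simp only [h1, h3]
          by_cases h4 : i = j
          · have : ¬ i = j - 1 := by omega
            simp [h4]
            omega
          · simp [h4]
        rw [sum_congr rfl this, sum_add_distrib, sum_ite_eq', sum_ite_eq',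
          if_pos (mem_range.2 (by omega)), if_pos (mem_range.2 (by omega))]
      · intro e he
        by_contra h0
        exact hvS (hX.mem_of_mem e h0 _ (mem_filter.1 he).2)
  -- Since at most one ear edge has weight zero, each inner vertex still reaches `p 0` or `p m`
  -- along the ear.
  · have hleft : ∀ j ≤ m, (∀ i < j, x i ≠ 0) →
        (weightGraph (fun e => X e + pathWeight p m x e)).Reachable (p 0) (p j) := by
      intro j
      induction j with
      | zero => intro _ _; rfl
      | succ j ih =>
        intro hj hz
        exact (ih (by omega) fun i hi => hz i (by omega)).trans (hstep j hj (hz j (by omega)))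
    have hright : ∀ k ≤ m, (∀ i < m, m - k ≤ i → x i ≠ 0) →
        (weightGraph (fun e => X e + pathWeight p m x e)).Reachable (p (m - k)) (p m) := by
      intro k
      induction k with
      | zero => intro _ _; rfl
      | succ k ih =>
        intro hk hz
        have h1 := hstep (m - (k + 1)) (by omega) (hz _ (by omega) le_rfl)
        rw [show m - (k + 1) + 1 = m - k by omega] at h1
        exact h1.trans (ih (by omega) fun i hi hi' => hz i hi (by omega))
    have hS : ∀ v ∈ addEar S p m, ∃ s ∈ S,
        (weightGraph (fun e => X e + pathWeight p m x e)).Reachable v s := by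
      intro v hv
      rw [addEar, mem_union] at hv
      rcases hv with hv | hv
      · exact ⟨v, hv, .rfl⟩
      obtain ⟨j, hj, rfl⟩ := mem_image.1 hv
      rw [mem_Ico] at hj
      by_cases hz : ∀ i < j, x i ≠ 0
      · exact ⟨p 0, h.fst_mem, (hleft j hj.2.le hz).symm⟩
      · push Not at hz
        obtain ⟨z, hzj, hz⟩ := hz
        have h1 := hright (m - j) (by omega) fun i hi hi' h0 => by
          have := hx z (by omega) i hi hz h0
          omega
        rw [show m - (m - j) = j by omega] at h1
        exact ⟨p m, h.lst_mem, h1⟩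
    intro u hu v hv
    obtain ⟨s, hs, hus⟩ := hS u hu
    obtain ⟨t, ht, hvt⟩ := hS v hv
    exact hus.trans (((hX.reachable s hs t ht).mono hmono).trans hvt.symm)

/-! ### Choosing ear weights and enlarging flexible sets -/

/-- The weights along an ear determined by the first one and the demands `g` at inner vertices. -/
def earWeight (g : ℕ → ZMod 4) (b : ZMod 4) : ℕ → ZMod 4
  | 0 => b
  | i + 1 => g (i + 1) - earWeight g b i

theorem earWeight_injective (g : ℕ → ZMod 4) (i : ℕ) :
    Function.Injective fun b => earWeight g b i := by
  induction i with
  | zero => exact fun _ _ h => h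
  | succ i ih => exact fun a b h => ih (sub_right_injective h)

/-- Double counting of pairs (start value, vanishing edge): each edge vanishes for at most one start
value, so there are at most 7 pairs, whereas two zeros for each of the four start values would give
8. -/
theorem exists_earWeight (g : ℕ → ZMod 4) {m : ℕ} (hm : m ≤ 7) :
    ∃ b, ∀ i < m, ∀ j < m, earWeight g b i = 0 → earWeight g b j = 0 → i = j := by
  by_contra! hcon
  have h1 : ∀ b ∈ (univ : Finset (ZMod 4)), 2 ≤ #{i ∈ range m | earWeight g b i = 0} := by
    intro b _
    obtain ⟨i, hi, j, hj, h1, h2, hij⟩ := hcon b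
    exact one_lt_card.2 ⟨i, by simp [hi, h1], j, by simp [hj, h2], hij⟩
  have h2 : ∀ i ∈ range m, #{b : ZMod 4 | earWeight g b i = 0} ≤ 1 := by
    intro i _
    refine card_le_one.2 fun a ha b hb => earWeight_injective g i ?_
    simp only [mem_filter, mem_univ, true_and] at ha hb
    simp [ha, hb]
  have h3 := sum_card_bipartiteAbove_eq_sum_card_bipartiteBelow
    (s := (univ : Finset (ZMod 4))) (t := range m) (fun b i => earWeight g b i = 0)
  have h4 := card_nsmul_le_sum _ _ _ h1
  have h5 := sum_le_card_nsmul _ _ _ h2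
  simp only [bipartiteAbove, bipartiteBelow] at h3
  simp only [card_univ, ZMod.card, card_range, smul_eq_mul] at h4 h5
  omega

/-- The sum telescopes because `c` changes sign along each edge. Hence the demand left on `S` stays
orthogonal to `c` whatever the start value. -/
theorem sum_alternating {c : V → ZMod 4} {p : ℕ → V} (x : ℕ → ZMod 4) {m : ℕ} (hm : 1 ≤ m)
    (hc : ∀ i < m, c (p (i + 1)) = -c (p i)) :
    ∑ i ∈ Ico 1 m, c (p i) * (x (i - 1) + x i) = -c (p 0) * x 0 - c (p m) * x (m - 1) := by
  induction m, hm using Nat.le_induction with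
  | base => simp [hc 0]
  | succ m hm ih =>
    rw [sum_Ico_succ_top hm, ih fun i hi => hc i (by omega), hc m (by omega),
      Nat.add_sub_cancel]
    ring

theorem IsEar.sum_addEar {S : Finset V} {p : ℕ → V} {m : ℕ} (h : IsEar G S p m)
    (g : V → ZMod 4) : ∑ v ∈ addEar S p m, g v = ∑ v ∈ S, g v + ∑ i ∈ Ico 1 m, g (p i) := by
  rw [addEar, sum_union, sum_image]
  · intro i hi j hj hij
    simp only [coe_Ico, Set.mem_Ico] at hi hj
    exact h.inj i j (by omega) hi.2 (by omega) hj.2 hij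
  · rw [disjoint_right]
    intro v hv
    obtain ⟨i, hi, rfl⟩ := mem_image.1 hv
    rw [mem_Ico] at hi
    exact h.inner i (by omega) hi.2

theorem IsEar.sum_sub {S : Finset V} {p : ℕ → V} {m : ℕ} (h : IsEar G S p m)
    (c f : V → ZMod 4) (a b : ZMod 4) :
    ∑ v ∈ S, c v * (f v - ((if v = p 0 then a else 0) + (if v = p m then b else 0))) =
      ∑ v ∈ S, c v * f v - (c (p 0) * a + c (p m) * b) := by
  simp only [mul_sub, mul_add, sum_sub_distrib, sum_add_distrib, mul_ite, mul_zero]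
  rw [sum_ite_eq', sum_ite_eq', if_pos h.fst_mem, if_pos h.lst_mem]

theorem Flexible.addEar {S : Finset V} {c : V → ZMod 4} (hS : Flexible G S c) {p : ℕ → V} {m : ℕ}
    (h : IsEar G S p m) (hm : m ≤ 7) (hc : ∀ i < m, c (p (i + 1)) = -c (p i)) :
    Flexible G (addEar S p m) c := by
  intro f hf
  obtain ⟨b, hb⟩ := exists_earWeight (fun i => f (p i)) hm
  have hfp : ∀ i, 0 < i → i < m → f (p i) =
      earWeight (fun i => f (p i)) b (i - 1) + earWeight (fun i => f (p i)) b i := by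
    intro i hi _
    obtain ⟨i, rfl⟩ : ∃ k, i = k + 1 := ⟨i - 1, by omega⟩
    simp [earWeight]
  obtain ⟨X, hX⟩ := hS _ (by
    rw [h.sum_sub c f (earWeight (fun i => f (p i)) b 0) (earWeight (fun i => f (p i)) b (m - 1))]
    have hsum := sum_congr (rfl : Ico 1 m = Ico 1 m) fun i hi => congrArg (c (p i) * ·)
      (hfp i (mem_Ico.1 hi).1 (mem_Ico.1 hi).2)
    rw [h.sum_addEar, hsum, sum_alternating _ (by have := h.two_le; omega) hc] at hf
    rw [← hf]
    ring)
  exact ⟨_, h.isConnectedFactorOn hb hfp hX⟩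

/-- The same pigeonhole with a constrained start value: `K = 2 * b` leaves two candidates for `b`,
and three edges give at most three zeros among them. -/
theorem exists_odd_ear_weight : ∀ K f₁ f₂ : ZMod 4, 2 * K = 0 → ∃ b, K = 2 * b ∧
    ¬ (b = 0 ∧ f₁ - b = 0) ∧ ¬ (b = 0 ∧ f₂ - (f₁ - b) = 0) ∧
    ¬ (f₁ - b = 0 ∧ f₂ - (f₁ - b) = 0) := by
  decide

/-- Attaching an ear of length 3 that violates the bipartition. -/
theorem Flexible.addEar_odd {S : Finset V} {c : V → ZMod 4} (hS : Flexible G S c) {p : ℕ → V}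
    (h : IsEar G S p 3) (hc : ∀ v ∈ S, 2 * c v = 2) (hp : c (p 0) = c (p 3)) :
    Flexible G (ModFour.addEar S p 3) (fun _ => 2) := by
  intro f hf
  have hc0 := hc _ h.fst_mem
  have h4 : (4 : ZMod 4) = 0 := rfl
  -- The end weights are `b` and `f (p 2) - f (p 1) + b`. With equal signs at the two ends,
  -- orthogonality of the remaining demand on `S` becomes `K = 2 * b` for this `K`; the even total
  -- of `f` gives `2 * K = 0`.
  obtain ⟨b, hb, h01, h02, h12⟩ := exists_odd_ear_weight
    (∑ v ∈ S, c v * f v - c (p 0) * (f (p 2) - f (p 1))) (f (p 1)) (f (p 2)) (by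
      rw [mul_sub, mul_sum, sum_congr rfl fun v hv => by rw [← mul_assoc, hc v hv], ← mul_assoc,
        hc0]
      rw [h.sum_addEar, sum_Ico_eq_sum_range] at hf
      simp [sum_range_succ] at hf
      linear_combination hf - f (p 2) * h4)
  have hx : ∀ i < 3, ∀ j < 3, earWeight (fun i => f (p i)) b i = 0 →
      earWeight (fun i => f (p i)) b j = 0 → i = j := by
    intro i hi j hj h1 h2
    interval_cases i <;> interval_cases j <;> simp only [earWeight] at h1 h2 <;> tauto
  have hfp : ∀ i, 0 < i → i < 3 → f (p i) =
      earWeight (fun i => f (p i)) b (i - 1) + earWeight (fun i => f (p i)) b i := by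
    intro i hi _
    obtain ⟨i, rfl⟩ : ∃ k, i = k + 1 := ⟨i - 1, by omega⟩
    simp [earWeight]
  obtain ⟨X, hX⟩ := hS _ (by
    rw [h.sum_sub c f (earWeight (fun i => f (p i)) b 0) (earWeight (fun i => f (p i)) b (3 - 1))]
    simp only [earWeight]
    rw [← hp]
    linear_combination hb - b * hc0)
  exact ⟨_, h.isConnectedFactorOn hx hfp hX⟩

theorem exists_bridge_weight : ∀ K : ZMod 4, ∃ b : ZMod 4, b ≠ 0 ∧ 2 * K = 2 * b := by
  decide

/-- The bridge weight has to match the parity of the demand on `S`. Both parities occur among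
nonzero residues, so the bridge can always be kept in the support. -/
theorem Flexible.bridge {S T : Finset V} (hS : Flexible G S (fun _ => 2))
    (hT : Flexible G T (fun _ => 2)) (hST : Disjoint S T) {s t : V} (hs : s ∈ S) (ht : t ∈ T)
    (hst : G.Adj s t) : Flexible G (S ∪ T) (fun _ => 2) := by
  intro f hf
  rw [sum_union hST, ← mul_sum, ← mul_sum] at hf
  have h4 : (4 : ZMod 4) = 0 := rfl
  obtain ⟨b, hb0, hb⟩ := exists_bridge_weight (∑ v ∈ S, f v)
  obtain ⟨X, hX⟩ := hS (fun v => f v - if v = s then b else 0) (by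
    rw [← mul_sum, sum_sub_distrib, sum_ite_eq', if_pos hs]
    linear_combination hb)
  obtain ⟨Y, hY⟩ := hT (fun v => f v - if v = t then b else 0) (by
    rw [← mul_sum, sum_sub_distrib, sum_ite_eq', if_pos ht]
    linear_combination hf - hb - b * h4)
  have hsT : s ∉ T := disjoint_left.1 hST hs
  have htS : t ∉ S := disjoint_right.1 hST ht
  have hXT : ∀ e v, v ∈ e → v ∉ S → X e = 0 := fun e v hv hvS => by
    by_contra h0; exact hvS (hX.mem_of_mem e h0 v hv)
  have hYS : ∀ e v, v ∈ e → v ∉ T → Y e = 0 := fun e v hv hvS => by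
    by_contra h0; exact hvS (hY.mem_of_mem e h0 v hv)
  have hXe := hXT s(s, t) t (by simp) htS
  have hYe := hYS s(s, t) s (by simp) hsT
  have hXY : ∀ e, X e ≠ 0 → Y e = 0 := by
    intro e he
    induction e with | _ u v =>
    exact hYS _ u (by simp) (disjoint_left.1 hST (hX.mem_of_mem _ he u (by simp)))
  have hYX : ∀ e, Y e ≠ 0 → X e = 0 := fun e he => by
    by_contra h0; exact he (hXY e h0)
  set Z : Sym2 V → ZMod 4 := fun e => X e + Y e + if e = s(s, t) then b else 0 with hZ
  have hZX : ∀ e, X e ≠ 0 → Z e ≠ 0 := by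
    intro e he
    have : e ≠ s(s, t) := by rintro rfl; exact he hXe
    simpa [hZ, hXY e he, this] using he
  have hZY : ∀ e, Y e ≠ 0 → Z e ≠ 0 := by
    intro e he
    have : e ≠ s(s, t) := by rintro rfl; exact he hYe
    simpa [hZ, hYX e he, this] using he
  have hor : ∀ e, Z e ≠ 0 → X e ≠ 0 ∨ Y e ≠ 0 ∨ e = s(s, t) := by
    intro e he
    by_contra! h'
    simp [hZ, h'] at he
  have hdeg : ∀ v, ∑ e with v ∈ e, Z e =
      ∑ e with v ∈ e, X e + ∑ e with v ∈ e, Y e + if v = s ∨ v = t then b else 0 := by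
    intro v
    rw [hZ, sum_add_distrib, sum_add_distrib, sum_ite_eq']
    simp
  refine ⟨Z, fun e he => ?_, fun e he v hv => ?_, fun v hv => ?_, ?_⟩
  · rcases hor e he with h | h | rfl
    · exact hX.mem_edgeSet e h
    · exact hY.mem_edgeSet e h
    · exact hst
  · rcases hor e he with h | h | rfl
    · exact mem_union_left _ (hX.mem_of_mem e h v hv)
    · exact mem_union_right _ (hY.mem_of_mem e h v hv)
    · rcases Sym2.mem_iff.1 hv with rfl | rfl
      · exact mem_union_left _ hs
      · exact mem_union_right _ ht
  · rw [hdeg]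
    by_cases hvS : v ∈ S
    · have hvT : v ∉ T := disjoint_left.1 hST hvS
      have hvt : v ≠ t := by rintro rfl; exact hvT ht
      rw [hX.sum_eq v hvS, sum_eq_zero fun e he => hYS e v (mem_filter.1 he).2 hvT]
      simp [hvt]
    · have hvT : v ∈ T := (mem_union.1 hv).resolve_left hvS
      have hvs : v ≠ s := by rintro rfl; exact hvS hs
      rw [hY.sum_eq v hvT, sum_eq_zero fun e he => hXT e v (mem_filter.1 he).2 hvS]
      simp [hvs]
  · have hst' : (weightGraph Z).Reachable s t := by
      refine SimpleGraph.Adj.reachable (weightGraph_adj.2 ⟨?_, hst.ne⟩)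
      simp [hZ, hXe, hYe, hb0]
    have hmX : weightGraph X ≤ weightGraph Z := fun u v huv => by
      rw [weightGraph_adj] at huv ⊢; exact ⟨hZX _ huv.1, huv.2⟩
    have hmY : weightGraph Y ≤ weightGraph Z := fun u v huv => by
      rw [weightGraph_adj] at huv ⊢; exact ⟨hZY _ huv.1, huv.2⟩
    have hall : ∀ v ∈ S ∪ T, (weightGraph Z).Reachable s v := by
      intro v hv
      rcases mem_union.1 hv with hv | hv
      · exact (hX.reachable s hs v hv).mono hmX
      · exact hst'.trans ((hY.reachable t ht v hv).mono hmY)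
    exact fun u hu v hv => (hall u hu).symm.trans (hall v hv)

/-- With a unit coefficient the only admissible demand is zero. -/
theorem flexible_singleton (v : V) {c : V → ZMod 4} (hc : IsUnit (c v)) : Flexible G {v} c := by
  intro f hf
  rw [sum_singleton, hc.mul_right_eq_zero] at hf
  refine ⟨0, by simp, by simp, ?_, ?_⟩
  · simp [hf]
  · intro u hu w hw
    rw [mem_singleton] at hu hw
    rw [hu, hw]

end

/-! ### Flexible starting sets in nonbipartite graphs -/

section

/-- A list of vertices read as a sequence. -/
def seq (a : V) (l : List V) (i : ℕ) : V := l.getD i a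

/-- The triangle is a closed odd ear of length 3 on one vertex. -/
theorem flexible_triangle {a b c : V} (hab : G.Adj a b) (hbc : G.Adj b c) (hca : G.Adj c a) :
    Flexible G {a, b, c} (fun _ => 2) := by
  have h : IsEar G {a} (seq a [a, b, c, a]) 3 := by
    refine ⟨by simp, by simp, by simp [seq], by simp [seq], ?_, ?_, ?_⟩
    · intro i h0 h3
      interval_cases i <;> simp [seq, hab.ne', hca.ne]
    · intro i j hi hi' hj hj'
      interval_cases i <;> interval_cases j <;> simp [seq, hbc.ne, hbc.ne']
    · intro i hi
      interval_cases i <;> simpa [seq]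
  have h1 := (flexible_singleton (G := G) a (c := fun _ => 1) isUnit_one).addEar_odd h
    (by simp) rfl
  have : addEar {a} (seq a [a, b, c, a]) 3 = {a, b, c} := by
    rw [addEar, show Ico 1 3 = {1, 2} from rfl]
    ext x
    simp [seq]
    tauto
  rwa [this] at h1

/-- The even cycle `a b c v` is a closed ear respecting the signs `s`. The path `a e d c` then joins
two vertices of equal sign by an odd ear, and only parity remains as a constraint. -/
theorem flexible_house {a b c d e v : V} (hab : G.Adj a b) (hbc : G.Adj b c) (hcd : G.Adj c d)
    (hde : G.Adj d e) (hea : G.Adj e a) (hva : G.Adj v a) (hvc : G.Adj v c)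
    (hne : [a, b, c, d, e, v].Nodup) :
    Flexible G {a, b, c, v, e, d} (fun _ => 2) := by
  simp only [List.nodup_cons, List.mem_cons, List.not_mem_nil, or_false, not_or,
    List.nodup_nil, not_false_eq_true, and_true] at hne
  obtain ⟨⟨nab, nac, nad, nae, nav⟩, ⟨nbc, nbd, nbe, nbv⟩, ⟨ncd, nce, ncv⟩, ⟨nde, ndv⟩, nev⟩ := hne
  let s : V → ZMod 4 := fun x => if x = b ∨ x = v then -1 else 1
  have sa : s a = 1 := by simp [s, nab, nav]
  have sb : s b = -1 := by simp [s]
  have sc : s c = 1 := by simp [s, Ne.symm nbc, ncv]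
  have sv : s v = -1 := by simp [s]
  have h : IsEar G {a} (seq a [a, b, c, v, a]) 4 := by
    refine ⟨by simp, by simp, by simp [seq], by simp [seq], ?_, ?_, ?_⟩
    · intro i h0 h3
      interval_cases i <;> simp [seq, Ne.symm nab, Ne.symm nac, Ne.symm nav]
    · intro i j hi hi' hj hj'
      interval_cases i <;> interval_cases j <;>
        simp [seq, nbc, nbv, ncv, Ne.symm nbc, Ne.symm nbv, Ne.symm ncv]
    · intro i hi
      interval_cases i <;> simpa [seq] using by first | assumption | exact hvc.symm
  have h1 := (flexible_singleton (G := G) a (c := s) (by simp [sa])).addEar h (by simp) (by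
    intro i hi
    interval_cases i <;> simp [seq, sa, sb, sc, sv])
  have h2 : addEar {a} (seq a [a, b, c, v, a]) 4 = {a, b, c, v} := by
    rw [addEar, show Ico 1 4 = {1, 2, 3} from rfl]
    ext x
    simp [seq]
    tauto
  rw [h2] at h1
  have h3 : IsEar G {a, b, c, v} (seq a [a, e, d, c]) 3 := by
    refine ⟨by simp, by simp, by simp [seq], by simp [seq], ?_, ?_, ?_⟩
    · intro i h0 h3
      interval_cases i <;> simp [seq, Ne.symm nae, Ne.symm nad, Ne.symm nbe, Ne.symm nbd,
        Ne.symm nce, Ne.symm ncd, nev, ndv]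
    · intro i j hi hi' hj hj'
      interval_cases i <;> interval_cases j <;> simp [seq, nde, Ne.symm nde]
    · intro i hi
      interval_cases i <;> simpa [seq] using SimpleGraph.Adj.symm (by assumption)
  have h4 := h1.addEar_odd h3 (by
    intro x _
    by_cases hx : x = b ∨ x = v
    · simp only [s, if_pos hx]; decide
    · simp [s, if_neg hx]) (by simp [seq, sa, sc])
  have h5 : addEar {a, b, c, v} (seq a [a, e, d, c]) 3 = {a, b, c, v, e, d} := by
    rw [addEar, show Ico 1 3 = {1, 2} from rfl]
    ext x
    simp [seq]
    tauto
  rwa [h5] at h4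

/-- Walks along a sequence of consecutively adjacent vertices. -/
theorem exists_walk_of_seq {p : ℕ → V} {L : ℕ} (hp : ∀ i < L, G.Adj (p i) (p (i + 1))) {i j : ℕ}
    (hij : i ≤ j) (hj : j ≤ L) : ∃ q : G.Walk (p i) (p j), q.length = j - i := by
  induction j, hij using Nat.le_induction with
  | base => exact ⟨.nil, by simp⟩
  | succ j hij ih =>
    obtain ⟨q, hq⟩ := ih (by omega)
    exact ⟨q.concat (hp j hj), by rw [SimpleGraph.Walk.length_concat, hq]; omega⟩

/-- Two neighbours of a vertex on a shortest odd closed walk are at distance two along it. -/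
theorem dist_of_min_odd {p : ℕ → V} {L : ℕ} (hp : ∀ i < L, G.Adj (p i) (p (i + 1)))
    (hpL : p L = p 0) (hL : Odd L)
    (hmin : ∀ (u : V) (w : G.Walk u u), Odd w.length → L ≤ w.length) {v : V} {i j : ℕ}
    (hij : i < j) (hj : j < L) (hi' : G.Adj v (p i)) (hj' : G.Adj v (p j)) :
    j - i = 2 ∨ j - i + 2 = L := by
  obtain ⟨q, hq⟩ := exists_walk_of_seq hp hij.le hj.le
  obtain ⟨q₁, hq₁⟩ := exists_walk_of_seq hp hj.le le_rfl
  obtain ⟨q₀, hq₀⟩ := exists_walk_of_seq hp (Nat.zero_le i) (hij.le.trans hj.le)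
  -- The positions `i`, `j` cut the closed walk into two arcs of opposite parity. Closing the odd
  -- arc through `v` gives an odd closed walk, so by minimality the even arc has length at most 2.
  have h1 := hmin v (.cons hi' (q.concat hj'.symm))
  have h2 := hmin v (.cons hj' ((q₁.append (q₀.copy hpL.symm rfl)).concat hi'.symm))
  simp only [SimpleGraph.Walk.length_cons, SimpleGraph.Walk.length_concat,
    SimpleGraph.Walk.length_append, SimpleGraph.Walk.length_copy, hq, hq₁, hq₀] at h1 h2
  rcases Nat.even_or_odd (j - i) with he | ho
  · have : Odd (L - j + (i - 0) + 1 + 1) := by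
      rw [Nat.odd_iff] at hL ⊢
      rw [Nat.even_iff] at he
      omega
    have := h2 this
    rw [Nat.even_iff] at he
    omega
  · have := h1 (by rw [Nat.odd_iff] at ho ⊢; omega)
    rw [Nat.odd_iff] at ho hL
    omega

variable [DecidableRel G.Adj]

/-- If the shortest odd closed walk had length `L ≥ 7`, each vertex would be adjacent to at most two
of its positions, and double counting would give `L * d ≤ 2 * |V| ≤ 6 * d`. -/
theorem exists_short_odd_walk {d : ℕ} (hd : ∀ v, d ≤ G.degree v) (hd0 : 0 < d)
    (hn : Fintype.card V ≤ 3 * d) (hG : ¬ G.IsBipartite) :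
    ∃ (u : V) (w : G.Walk u u), Odd w.length ∧ w.length ≤ 5 := by
  classical
  have hex : ∃ L, ∃ (u : V) (w : G.Walk u u), Odd w.length ∧ w.length = L := by
    by_contra! h
    refine hG (SimpleGraph.two_colorable_iff_forall_loop_even.2 fun u w => ?_)
    by_contra h'
    exact h _ u w (Nat.not_even_iff_odd.1 h') rfl
  obtain ⟨u, w, hw, hwL⟩ := Nat.find_spec hex
  have hmin : ∀ (u : V) (w' : G.Walk u u), Odd w'.length → w.length ≤ w'.length := by
    intro u' w' hw'
    rw [hwL]
    exact Nat.find_min' hex ⟨u', w', hw', rfl⟩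
  refine ⟨u, w, hw, ?_⟩
  by_contra! h5
  have hp : ∀ i < w.length, G.Adj (w.getVert i) (w.getVert (i + 1)) :=
    fun i hi => w.adj_getVert_succ hi
  have hpL : w.getVert w.length = w.getVert 0 := by simp
  have h1 : ∀ v ∈ (univ : Finset V), #{i ∈ range w.length | G.Adj v (w.getVert i)} ≤ 2 := by
    intro v _
    by_contra! h3
    have hd := @dist_of_min_odd _ _ _ G w.getVert w.length hp hpL hw hmin v
    rw [Nat.odd_iff] at hw
    obtain ⟨a, ha, b, hb, c, hc, hab, hac, hbc⟩ := two_lt_card.1 h3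
    simp only [mem_filter, mem_range] at ha hb hc
    have key : ∀ i j, i ≠ j → i < w.length → G.Adj v (w.getVert i) → j < w.length →
        G.Adj v (w.getVert j) → j = i + 2 ∨ i = j + 2 ∨ j + 2 = w.length + i ∨
          i + 2 = w.length + j := by
      intro i j hij hi hi' hj hj'
      rcases lt_or_gt_of_ne hij with h | h
      · have := hd h hj hi' hj'
        omega
      · have := hd h hi hj' hi'
        omega
    have k1 := key a b hab ha.1 ha.2 hb.1 hb.2
    have k2 := key a c hac ha.1 ha.2 hc.1 hc.2
    have k3 := key b c hbc hb.1 hb.2 hc.1 hc.2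
    -- Three positions pairwise at cyclic distance 2 would force length 6, which is not odd.
    omega
  have h2 : ∀ i ∈ range w.length, d ≤ #{v | G.Adj v (w.getVert i)} := by
    intro i _
    refine (hd (w.getVert i)).trans_eq ?_
    rw [← SimpleGraph.card_neighborFinset_eq_degree]
    congr 1
    ext v
    simp [G.adj_comm]
  have h3 := sum_card_bipartiteAbove_eq_sum_card_bipartiteBelow
    (s := (univ : Finset V)) (t := range w.length) (fun v i => G.Adj v (w.getVert i))
  have h4 := card_nsmul_le_sum _ _ _ h2
  have h5 := sum_le_card_nsmul _ _ _ h1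
  simp only [bipartiteAbove, bipartiteBelow] at h3
  simp only [card_univ, card_range, smul_eq_mul] at h4 h5
  rw [Nat.odd_iff] at hw
  have : 7 ≤ w.length := by omega
  nlinarith

theorem exists_triangle_or_pentagon {d : ℕ} (hd : ∀ v, d ≤ G.degree v) (hd0 : 0 < d)
    (hn : Fintype.card V ≤ 3 * d) (hG : ¬ G.IsBipartite) :
    (∃ a b c, G.Adj a b ∧ G.Adj b c ∧ G.Adj c a) ∨
      ∃ a b c d e, G.Adj a b ∧ G.Adj b c ∧ G.Adj c d ∧ G.Adj d e ∧ G.Adj e a := by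
  obtain ⟨u, w, hw, h5⟩ := exists_short_odd_walk hd hd0 hn hG
  rw [Nat.odd_iff] at hw
  have hp := fun i (hi : i < w.length) => w.adj_getVert_succ hi
  have hL := w.getVert_length
  have h0 := w.getVert_zero
  rcases (by omega : w.length = 1 ∨ w.length = 3 ∨ w.length = 5) with h | h | h <;>
    rw [h] at hp hL
  · have := hp 0 (by omega)
    rw [zero_add, h0, hL] at this
    exact absurd this (G.irrefl)
  · have h2 := hp 2 (by omega)
    rw [hL.trans h0.symm] at h2
    exact .inl ⟨_, _, _, hp 0 (by omega), hp 1 (by omega), h2⟩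
  · have h2 := hp 4 (by omega)
    rw [hL.trans h0.symm] at h2
    exact .inr ⟨_, _, _, _, _, hp 0 (by omega), hp 1 (by omega), hp 2 (by omega),
      hp 3 (by omega), h2⟩

/-- The pentagon with vertices `a, b, c, d, e`. -/
structure IsPentagon (G : SimpleGraph V) (a b c d e : V) : Prop where
  ab : G.Adj a b
  bc : G.Adj b c
  cd : G.Adj c d
  de : G.Adj d e
  ea : G.Adj e a

theorem IsPentagon.rotate {a b c d e : V} (h : IsPentagon G a b c d e) : IsPentagon G b c d e a :=
  ⟨h.bc, h.cd, h.de, h.ea, h.ab⟩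

theorem IsPentagon.not_adj {a b c d e : V} (h : IsPentagon G a b c d e)
    (hT : ∀ x y z, G.Adj x y → G.Adj y z → ¬ G.Adj z x) : ¬ G.Adj a c ∧ ¬ G.Adj c a :=
  ⟨fun h' => hT _ _ _ h.ab h.bc h'.symm, fun h' => hT _ _ _ h.ab h.bc h'⟩

theorem IsPentagon.ne {a b c d e : V} (h : IsPentagon G a b c d e)
    (hT : ∀ x y z, G.Adj x y → G.Adj y z → ¬ G.Adj z x) : a ≠ c := by
  rintro rfl
  exact hT _ _ _ h.cd h.de h.ea

theorem IsPentagon.nodup {a b c d e : V} (h : IsPentagon G a b c d e)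
    (hT : ∀ x y z, G.Adj x y → G.Adj y z → ¬ G.Adj z x) : [a, b, c, d, e].Nodup := by
  simp [h.ab.ne, h.bc.ne, h.cd.ne, h.de.ne, h.ea.ne', h.ne hT, h.rotate.ne hT,
    h.rotate.rotate.ne hT, (h.rotate.rotate.rotate.ne hT).symm,
    (h.rotate.rotate.rotate.rotate.ne hT).symm]

theorem IsPentagon.nonempty_iso {a b c d e : V} (h : IsPentagon G a b c d e)
    (hT : ∀ x y z, G.Adj x y → G.Adj y z → ¬ G.Adj z x)
    (huniv : ∀ v, v ∈ ({a, b, c, d, e} : Finset V)) :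
    Nonempty (G ≃g SimpleGraph.cycleGraph 5) := by
  have hne := h.nodup hT
  let q : Fin 5 → V := fun i => [a, b, c, d, e].get i
  have hq : Function.Bijective q := by
    refine ⟨List.nodup_iff_injective_get.1 hne, fun v => ?_⟩
    have hv : v ∈ [a, b, c, d, e] := by simpa using huniv v
    obtain ⟨i, hi⟩ := List.mem_iff_get.1 hv
    exact ⟨i, hi⟩
  refine ⟨RelIso.symm ⟨Equiv.ofBijective q hq, ?_⟩⟩
  have n1 := h.not_adj hT
  have n2 := h.rotate.not_adj hT
  have n3 := h.rotate.rotate.not_adj hT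
  have n4 := h.rotate.rotate.rotate.not_adj hT
  have n5 := h.rotate.rotate.rotate.rotate.not_adj hT
  intro i j
  fin_cases i <;> fin_cases j <;>
    simp [q, h.ab, h.bc, h.cd, h.de, h.ea, h.ab.symm, h.bc.symm, h.cd.symm, h.de.symm, h.ea.symm,
      n1, n2, n3, n4, n5, SimpleGraph.cycleGraph_adj] <;> decide

theorem IsPentagon.exists_flexible {a b c d e : V} (h : IsPentagon G a b c d e)
    (hT : ∀ x y z, G.Adj x y → G.Adj y z → ¬ G.Adj z x) {v : V}
    (hv : v ∉ ({a, b, c, d, e} : Finset V)) (hva : G.Adj v a) (hvc : G.Adj v c) :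
    ∃ S : Finset V, S.Nonempty ∧ Flexible G S (fun _ => 2) := by
  refine ⟨_, ⟨a, mem_insert_self _ _⟩,
    flexible_house h.ab h.bc h.cd h.de h.ea hva hvc ?_⟩
  have : ([a, b, c, d, e] ++ [v]).Nodup := by
    rw [List.nodup_append]
    refine ⟨h.nodup hT, by simp, ?_⟩
    rintro x hx y hy rfl
    rw [List.mem_singleton] at hy
    subst hy
    exact hv (by simpa using hx)
  exact this

/-- Two neighbours on the pentagon would be either adjacent, giving a triangle, or at distance two,
which `hH` excludes after a rotation. -/
theorem IsPentagon.card_adj_le_one {a b c d e v : V} (h : IsPentagon G a b c d e)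
    (hT : ∀ x y z, G.Adj x y → G.Adj y z → ¬ G.Adj z x)
    (hv : v ∉ ({a, b, c, d, e} : Finset V))
    (hH : ∀ a b c d e v : V, IsPentagon G a b c d e → v ∉ ({a, b, c, d, e} : Finset V) →
      G.Adj v a → ¬ G.Adj v c) :
    #{x ∈ ({a, b, c, d, e} : Finset V) | G.Adj v x} ≤ 1 := by
  have hTv : ∀ {x y : V}, G.Adj x y → G.Adj v x → ¬ G.Adj v y := fun hxy hvx hvy =>
    hT _ _ _ hvx hxy hvy.symm
  simp only [mem_insert, mem_singleton, not_or] at hv hH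
  obtain ⟨v1, v2, v3, v4, v5⟩ := hv
  have n1 := hH _ _ _ _ _ v h ⟨v1, v2, v3, v4, v5⟩
  have n2 := hH _ _ _ _ _ v h.rotate ⟨v2, v3, v4, v5, v1⟩
  have n3 := hH _ _ _ _ _ v h.rotate.rotate ⟨v3, v4, v5, v1, v2⟩
  have n4 := hH _ _ _ _ _ v h.rotate.rotate.rotate ⟨v4, v5, v1, v2, v3⟩
  have n5 := hH _ _ _ _ _ v h.rotate.rotate.rotate.rotate ⟨v5, v1, v2, v3, v4⟩
  have t1 := hTv h.ab
  have t2 := hTv h.bc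
  have t3 := hTv h.cd
  have t4 := hTv h.de
  have t5 := hTv h.ea
  clear hH hT hTv h v1 v2 v3 v4 v5
  refine card_le_one.2 fun x hx y hy => ?_
  simp only [mem_filter, mem_insert, mem_singleton] at hx hy
  obtain ⟨rfl | rfl | rfl | rfl | rfl, hx⟩ := hx <;>
    obtain ⟨rfl | rfl | rfl | rfl | rfl, hy⟩ := hy <;>
    first
    | rfl
    | exact absurd hy (n1 hx) | exact absurd hx (n1 hy)
    | exact absurd hy (n2 hx) | exact absurd hx (n2 hy)
    | exact absurd hy (n3 hx) | exact absurd hx (n3 hy)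
    | exact absurd hy (n4 hx) | exact absurd hx (n4 hy)
    | exact absurd hy (n5 hx) | exact absurd hx (n5 hy)
    | exact absurd hy (t1 hx) | exact absurd hx (t1 hy)
    | exact absurd hy (t2 hx) | exact absurd hx (t2 hy)
    | exact absurd hy (t3 hx) | exact absurd hx (t3 hy)
    | exact absurd hy (t4 hx) | exact absurd hx (t4 hy)
    | exact absurd hy (t5 hx) | exact absurd hx (t5 hy)

theorem IsPentagon.card_adj_le_two {a b c d e v : V} (h : IsPentagon G a b c d e)
    (hT : ∀ x y z, G.Adj x y → G.Adj y z → ¬ G.Adj z x)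
    (hv : v ∈ ({a, b, c, d, e} : Finset V)) :
    #{x ∈ ({a, b, c, d, e} : Finset V) | G.Adj v x} ≤ 2 := by
  have key : ∀ {a b c d e : V}, IsPentagon G a b c d e → ∀ K : Finset V,
      (∀ x ∈ K, x = a ∨ x = b ∨ x = c ∨ x = d ∨ x = e) → #{x ∈ K | G.Adj a x} ≤ 2 := by
    intro a b c d e h K hK
    refine (card_le_card (t := {b, e}) fun x hx => ?_).trans card_le_two
    have n1 := (h.not_adj hT).1
    have n2 := (h.rotate.rotate.rotate.not_adj hT).2
    obtain ⟨hx, hax⟩ := mem_filter.1 hx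
    rcases hK x hx with rfl | rfl | rfl | rfl | rfl
    · exact absurd hax G.irrefl
    · simp
    · exact absurd hax n1
    · exact absurd hax n2
    · simp
  simp only [mem_insert, mem_singleton] at hv
  rcases hv with rfl | rfl | rfl | rfl | rfl
  · exact key h _ fun x hx => by simpa using hx
  · exact key h.rotate _ fun x hx => by simp only [mem_insert, mem_singleton] at hx; tauto
  · exact key h.rotate.rotate _ fun x hx => by simp only [mem_insert, mem_singleton] at hx; tauto
  · exact key h.rotate.rotate.rotate _ fun x hx => by
      simp only [mem_insert, mem_singleton] at hx; tauto
  · exact key h.rotate.rotate.rotate.rotate _ fun x hx => by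
      simp only [mem_insert, mem_singleton] at hx; tauto

/-- Without a triangle or a house, counting edges at a pentagon gives `5δ ≤ 10 + (|V| - 5)`, hence
`δ = 2` and `|V| ≤ 6`. Five vertices give the excluded 5-cycle; a sixth would have degree at most 1.
-/
theorem exists_flexible_start {δ : ℕ} (hd : ∀ v, δ ≤ G.degree v) (hδ : 2 ≤ δ)
    (hn : Fintype.card V ≤ 3 * δ) (hG : ¬ G.IsBipartite)
    (hC5 : ¬ Nonempty (G ≃g SimpleGraph.cycleGraph 5)) :
    ∃ S : Finset V, S.Nonempty ∧ Flexible G S (fun _ => 2) := by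
  by_contra hcon
  have hT : ∀ x y z, G.Adj x y → G.Adj y z → ¬ G.Adj z x := fun x y z h1 h2 h3 =>
    hcon ⟨_, ⟨x, mem_insert_self _ _⟩, flexible_triangle h1 h2 h3⟩
  obtain ⟨a, b, c, h1, h2, h3⟩ | ⟨a, b, c, d, e, h1, h2, h3, h4, h5⟩ :=
    exists_triangle_or_pentagon hd (by omega) hn hG
  · exact hT a b c h1 h2 h3
  have h : IsPentagon G a b c d e := ⟨h1, h2, h3, h4, h5⟩
  have hH : ∀ a b c d e v : V, IsPentagon G a b c d e → v ∉ ({a, b, c, d, e} : Finset V) →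
      G.Adj v a → ¬ G.Adj v c := fun _ _ _ _ _ _ h hv hva hvc => hcon (h.exists_flexible hT hv hva hvc)
  set K : Finset V := {a, b, c, d, e} with hK
  have hKcard : #K = 5 := by
    have := List.toFinset_card_of_nodup (h.nodup hT)
    simpa using this
  have hout : ∀ v ∉ K, #{x ∈ K | G.Adj v x} ≤ 1 := fun v hv => h.card_adj_le_one hT hv hH
  have hin : ∀ v ∈ K, #{x ∈ K | G.Adj v x} ≤ 2 := fun v hv => h.card_adj_le_two hT hv
  have hdeg : ∀ x ∈ K, δ ≤ #{v | G.Adj v x} := by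
    intro x _
    refine (hd x).trans_eq ?_
    rw [← SimpleGraph.card_neighborFinset_eq_degree]
    congr 1
    ext v
    simp [G.adj_comm]
  have e1 := sum_card_bipartiteAbove_eq_sum_card_bipartiteBelow
    (s := (univ : Finset V)) (t := K) (fun v x => G.Adj v x)
  have e2 := card_nsmul_le_sum _ _ _ hdeg
  have e3 := sum_le_card_nsmul _ _ _ hin
  have e4 := sum_le_card_nsmul Kᶜ _ _ fun v hv => hout v (mem_compl.1 hv)
  have e5 := card_compl K
  have e6 := card_le_univ K
  rw [← sum_add_sum_compl K] at e1
  simp only [bipartiteAbove, bipartiteBelow] at e1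
  simp only [smul_eq_mul, hKcard] at e2 e3 e4 e5 e6
  by_cases hall : ∀ v, v ∈ K
  · exact hC5 (h.nonempty_iso hT hall)
  · push Not at hall
    obtain ⟨v, hv⟩ := hall
    have f1 := hout v hv
    have f2 : G.neighborFinset v ⊆ {x ∈ K | G.Adj v x} ∪ Kᶜ.erase v := by
      intro x hx
      rw [SimpleGraph.mem_neighborFinset] at hx
      by_cases hxK : x ∈ K
      · exact mem_union_left _ (mem_filter.2 ⟨hxK, hx⟩)
      · exact mem_union_right _ (mem_erase.2 ⟨hx.ne', mem_compl.2 hxK⟩)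
    have f3 := card_le_card f2
    have f4 := card_union_le {x ∈ K | G.Adj v x} (Kᶜ.erase v)
    rw [card_erase_of_mem (mem_compl.2 hv)] at f4
    rw [SimpleGraph.card_neighborFinset_eq_degree] at f3
    have f5 := hd v
    have f6 : 0 < #Kᶜ := card_pos.2 ⟨v, mem_compl.2 hv⟩
    omega

end

/-! ### Maximal flexible sets and bridges -/

section

/-- `S` has no ear that is short enough to be attached. -/
def NoShortEar (G : SimpleGraph V) (S : Finset V) : Prop := ∀ p m, IsEar G S p m → 7 < m

/-- The edges of `G` that avoid `S`. -/
def outside (G : SimpleGraph V) (S : Finset V) : SimpleGraph V where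
  Adj u v := G.Adj u v ∧ u ∉ S ∧ v ∉ S
  symm := ⟨fun _ _ h => ⟨h.1.symm, h.2.2, h.2.1⟩⟩
  loopless := ⟨fun _ h => G.irrefl h.1⟩

/-- The edge `ws` is the only edge of `G` leaving `C`. -/
structure IsBridged (G : SimpleGraph V) (C : Finset V) (w s : V) : Prop where
  mem : w ∈ C
  not_mem : s ∉ C
  adj : G.Adj w s
  eq_of_adj : ∀ u ∈ C, ∀ v ∉ C, G.Adj u v → u = w ∧ v = s

theorem IsBridged.compl {C : Finset V} {w s : V} (h : IsBridged G C w s) :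
    IsBridged G Cᶜ s w := by
  refine ⟨by simpa using h.not_mem, by simpa using h.mem, h.adj.symm, fun u hu v hv huv => ?_⟩
  rw [mem_compl] at hu
  rw [mem_compl, not_not] at hv
  exact (h.eq_of_adj v hv u hu huv.symm).symm

theorem isEar_two {S : Finset V} {s v t : V} (hs : s ∈ S) (hv : v ∉ S) (ht : t ∈ S)
    (hsv : G.Adj s v) (hvt : G.Adj v t) (hst : s ≠ t) : IsEar G S (seq s [s, v, t]) 2 := by
  refine ⟨le_rfl, fun h => absurd h (by simpa [seq] using hst), by simpa [seq], by simpa [seq],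
    ?_, ?_, ?_⟩
  · intro i h0 h2
    interval_cases i
    simpa [seq]
  · intro i j hi hi' hj hj'
    omega
  · intro i hi
    interval_cases i <;> simpa [seq]

theorem isEar_four {S : Finset V} {s x y z t : V} (hs : s ∈ S) (hx : x ∉ S) (hy : y ∉ S)
    (hz : z ∉ S) (ht : t ∈ S) (h1 : G.Adj s x) (h2 : G.Adj x y) (h3 : G.Adj y z) (h4 : G.Adj z t)
    (hxz : x ≠ z) : IsEar G S (seq s [s, x, y, z, t]) 4 := by
  refine ⟨by simp, by simp, by simpa [seq], by simpa [seq], ?_, ?_, ?_⟩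
  · intro i h0 h2
    interval_cases i <;> simpa [seq]
  · intro i j hi hi' hj hj'
    interval_cases i <;> interval_cases j <;>
      simp [seq, hxz, hxz.symm, h2.ne, h2.ne', h3.ne, h3.ne']
  · intro i hi
    interval_cases i <;> simpa [seq]

theorem NoShortEar.eq_of_adj {S : Finset V} (hS : NoShortEar G S) {v s t : V} (hv : v ∉ S)
    (hs : s ∈ S) (ht : t ∈ S) (hvs : G.Adj v s) (hvt : G.Adj v t) : s = t := by
  by_contra hst
  exact absurd (hS _ _ (isEar_two hs hv ht hvs.symm hvt hst)) (by omega)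

/-- A path outside `S` whose ends have neighbours in `S` gives an ear. -/
theorem isEar_of_isPath {S : Finset V} {u v s t : V} (hu : u ∉ S) (huv : u ≠ v) (hs : s ∈ S)
    (ht : t ∈ S) (hus : G.Adj u s) (hvt : G.Adj v t) {w : (outside G S).Walk u v}
    (hw : w.IsPath) :
    IsEar G S (fun i => if i = 0 then s else if i ≤ w.length + 1 then w.getVert (i - 1) else t)
      (w.length + 2) := by
  have hpos : 0 < w.length := by
    by_contra h0
    exact huv (SimpleGraph.Walk.eq_of_length_eq_zero (by omega : w.length = 0))
  have hout : ∀ i ≤ w.length, w.getVert i ∉ S := by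
    intro i hi
    obtain rfl | h0 := Nat.eq_zero_or_pos i
    · simpa using hu
    · have := w.adj_getVert_succ (i := i - 1) (by omega)
      rw [Nat.sub_add_cancel h0] at this
      exact this.2.2
  refine ⟨by omega, by omega, by simpa, by simpa, ?_, ?_, ?_⟩
  · intro i h0 hi
    rw [if_neg (by omega), if_pos (by omega)]
    exact hout _ (by omega)
  · intro i j hi hi' hj hj' hij
    rw [if_neg (by omega), if_pos (by omega), if_neg (by omega), if_pos (by omega)] at hij
    have := hw.getVert_injOn (by simp; omega) (by simp; omega) hij
    omega
  · intro i hi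
    rw [if_neg (show i + 1 ≠ 0 by omega)]
    by_cases h0 : i = 0
    · subst h0
      simpa using hus.symm
    · rw [if_neg h0, if_pos (by omega)]
      by_cases h1 : i = w.length + 1
      · subst h1
        simpa using hvt
      · rw [if_pos (by omega)]
        have := (w.adj_getVert_succ (i := i - 1) (by omega)).1
        rwa [Nat.sub_add_cancel (by omega)] at this

/-- Any walk between vertices of a shortest walk is at least as long as the segment between. -/
theorem sub_le_length_of_geodesic {H : SimpleGraph V} {u v : V} {w : H.Walk u v}
    (hw : w.length = H.dist u v) {i j : ℕ} (hij : i ≤ j) (hj : j ≤ w.length)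
    (q : H.Walk (w.getVert i) (w.getVert j)) : j - i ≤ q.length := by
  have h := H.dist_le (((w.take i).append q).append (w.drop j))
  simp only [SimpleGraph.Walk.length_append, SimpleGraph.Walk.take_length,
    SimpleGraph.Walk.drop_length] at h
  rw [← hw] at h
  omega

variable [DecidableRel G.Adj] {δ : ℕ}

theorem NoShortEar.card_inter_le {S : Finset V} (hS : NoShortEar G S) {v : V} (hv : v ∉ S) :
    #(G.neighborFinset v ∩ S) ≤ 1 := by
  refine card_le_one.2 fun a ha b hb => ?_
  simp only [mem_inter, SimpleGraph.mem_neighborFinset] at ha hb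
  exact hS.eq_of_adj hv ha.2 hb.2 ha.1 hb.1

theorem NoShortEar.le_card {S : Finset V} (hS : NoShortEar G S) (hd : ∀ v, δ ≤ G.degree v) {v : V}
    (hv : v ∉ S) : δ ≤ #(insert v (G.neighborFinset v \ S)) := by
  rw [card_insert_of_notMem (by simp)]
  have h1 := hS.card_inter_le hv
  have h2 := card_sdiff_add_card_inter (G.neighborFinset v) S
  have h3 := hd v
  rw [SimpleGraph.card_neighborFinset_eq_degree] at h2
  omega

theorem exists_walk_of_mem {S : Finset V} {a x : V} (ha : a ∉ S)
    (hx : x ∈ insert a (G.neighborFinset a \ S)) :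
    ∃ q : (outside G S).Walk a x, q.length ≤ 1 := by
  rw [mem_insert, mem_sdiff, SimpleGraph.mem_neighborFinset] at hx
  rcases hx with rfl | ⟨h1, h2⟩
  · exact ⟨.nil, by simp⟩
  · exact ⟨.cons (show (outside G S).Adj a x from ⟨h1, ha, h2⟩) .nil, by simp⟩

/-- If `S` has no short ear, every component of `G - S` sends at most one edge to `S`. -/
theorem NoShortEar.unique_edge {S : Finset V} (hS : NoShortEar G S) (hd : ∀ v, δ ≤ G.degree v)
    (hn : Fintype.card V ≤ 3 * δ) {u v s t : V} (hu : u ∉ S) (hv : v ∉ S) (hs : s ∈ S)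
    (ht : t ∈ S) (hus : G.Adj u s) (hvt : G.Adj v t) (huv : (outside G S).Reachable u v) :
    u = v ∧ s = t := by
  obtain rfl | hne := eq_or_ne u v
  · exact ⟨rfl, hS.eq_of_adj hu hs ht hus hvt⟩
  exfalso
  obtain ⟨w, hwp, hw⟩ := huv.exists_path_of_dist
  have h7 := hS _ _ (isEar_of_isPath hu hne hs ht hus hvt hwp)
  have hout : ∀ i ≤ w.length, w.getVert i ∉ S := by
    intro i hi
    obtain rfl | h0 := Nat.eq_zero_or_pos i
    · simpa using hu
    · have := w.adj_getVert_succ (i := i - 1) (by omega)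
      rw [Nat.sub_add_cancel h0] at this
      exact this.2.2
  -- The path has length at least 6. The sets `B` at its positions 0, 3 and 6 are disjoint because
  -- it is a geodesic, and each has at least `δ` elements, since a vertex outside `S` has at most
  -- one neighbour in `S`. They avoid the nonempty `S`, contradicting `|V| ≤ 3δ`.
  let B : V → Finset V := fun a => insert a (G.neighborFinset a \ S)
  have hdisj : ∀ i j, i + 3 ≤ j → j ≤ w.length → Disjoint (B (w.getVert i)) (B (w.getVert j)) := by
    intro i j hij hj
    rw [disjoint_left]
    intro x hx hx'
    obtain ⟨q, hq⟩ := exists_walk_of_mem (hout i (by omega)) hx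
    obtain ⟨q', hq'⟩ := exists_walk_of_mem (hout j hj) hx'
    have := sub_le_length_of_geodesic hw (by omega) hj (q.append q'.reverse)
    rw [SimpleGraph.Walk.length_append, SimpleGraph.Walk.length_reverse] at this
    omega
  have h0 := hS.le_card hd (hout 0 (by omega))
  have h3 := hS.le_card hd (hout 3 (by omega))
  have h6 := hS.le_card hd (hout 6 (by omega))
  have hsub : B (w.getVert 0) ∪ B (w.getVert 3) ∪ B (w.getVert 6) ⊆ Sᶜ := by
    have : ∀ i ≤ w.length, B (w.getVert i) ⊆ Sᶜ := by
      intro i hi x hx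
      rw [mem_compl]
      rcases mem_insert.1 hx with rfl | hx
      · exact hout i hi
      · exact (mem_sdiff.1 hx).2
    exact union_subset (union_subset (this 0 (by omega)) (this 3 (by omega))) (this 6 (by omega))
  have hcard := card_le_card hsub
  rw [card_union_of_disjoint (disjoint_union_left.2 ⟨hdisj 0 6 (by omega) (by omega),
    hdisj 3 6 (by omega) (by omega)⟩), card_union_of_disjoint (hdisj 0 3 (by omega) (by omega)),
    card_compl] at hcard
  have hSpos : 0 < #S := card_pos.2 ⟨s, hs⟩
  have := card_le_univ S
  simp only [B] at hcard
  omega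

/-- `C` is the component of `x` in `G - S`: all edges leaving it end in `S`, connectedness supplies
one, and `unique_edge` allows no second. -/
theorem NoShortEar.exists_isBridged {S : Finset V} (hS : NoShortEar G S) (hG : G.Connected)
    (hd : ∀ v, δ ≤ G.degree v) (hn : Fintype.card V ≤ 3 * δ) (hne : S.Nonempty) {x : V}
    (hx : x ∉ S) : ∃ C w s, IsBridged G C w s ∧ s ∈ S ∧ Disjoint C S := by
  classical
  let C : Finset V := {v | v ∉ S ∧ (outside G S).Reachable x v}
  have hC : ∀ v, v ∈ C ↔ v ∉ S ∧ (outside G S).Reachable x v := by simp [C]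
  have hleave : ∀ u ∈ C, ∀ v ∉ C, G.Adj u v → v ∈ S := by
    intro u hu v hv huv
    rw [hC] at hu hv
    by_contra hvS
    have hadj : (outside G S).Adj u v := ⟨huv, hu.1, hvS⟩
    exact hv ⟨hvS, hu.2.trans hadj.reachable⟩
  obtain ⟨y, hy⟩ := hne
  obtain ⟨q⟩ := hG.preconnected x y
  obtain ⟨e, -, he1, he2⟩ := q.exists_boundary_dart (C : Set V)
    (by simp only [mem_coe, hC]; exact ⟨hx, .rfl⟩) (by simp only [mem_coe, hC]; tauto)
  rw [mem_coe] at he1 he2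
  have hsS := hleave _ he1 _ he2 e.adj
  refine ⟨C, e.fst, e.snd, ⟨he1, he2, e.adj, fun u hu v hv huv => ?_⟩, hsS, ?_⟩
  · have hvS := hleave u hu v hv huv
    rw [hC] at hu he1
    exact hS.unique_edge hd hn hu.1 he1.1 hvS hsS huv e.adj (hu.2.symm.trans he1.2)
  · rw [disjoint_left]
    intro v hv
    exact ((hC v).1 hv).1

theorem IsBridged.neighborFinset_subset {C : Finset V} {w s : V} (h : IsBridged G C w s) {u : V}
    (hu : u ∈ C) (huw : u ≠ w) : G.neighborFinset u ⊆ C := by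
  intro v hv
  rw [SimpleGraph.mem_neighborFinset] at hv
  by_contra hvC
  exact huw (h.eq_of_adj u hu v hvC hv).1

theorem IsBridged.exists_edge {C : Finset V} {w s : V} (h : IsBridged G C w s)
    (hd : ∀ v, δ ≤ G.degree v) (hδ : 2 ≤ δ) :
    ∃ u ∈ C, ∃ u' ∈ C, u ≠ w ∧ u' ≠ w ∧ G.Adj u u' := by
  have hcard : ∀ v, 1 < #(G.neighborFinset v) := by
    intro v
    rw [SimpleGraph.card_neighborFinset_eq_degree]
    exact lt_of_lt_of_le (by omega) (hd v)
  obtain ⟨u, hu, hus⟩ := exists_mem_ne (hcard w) s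
  rw [SimpleGraph.mem_neighborFinset] at hu
  have huC : u ∈ C := by
    by_contra huC
    exact hus (h.eq_of_adj w h.mem u huC hu).2
  obtain ⟨u', hu', huw'⟩ := exists_mem_ne (hcard u) w
  refine ⟨u, huC, u', h.neighborFinset_subset huC hu.ne' hu', hu.ne', huw', ?_⟩
  rwa [SimpleGraph.mem_neighborFinset] at hu'

theorem IsBridged.lt_card {C : Finset V} {w s : V} (h : IsBridged G C w s)
    (hd : ∀ v, δ ≤ G.degree v) (hδ : 2 ≤ δ) : δ < #C := by
  obtain ⟨u, hu, -, -, huw, -, -⟩ := h.exists_edge hd hδ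
  have h1 := card_le_card (insert_subset hu (h.neighborFinset_subset hu huw))
  rw [card_insert_of_notMem (by simp), SimpleGraph.card_neighborFinset_eq_degree] at h1
  have := hd u
  omega

/-- The ends of an edge avoiding `w` have all their neighbours in `C`, and these neighbourhoods are
disjoint in a triangle-free graph. -/
theorem IsBridged.two_mul_le_card {C : Finset V} {w s : V} (h : IsBridged G C w s)
    (hd : ∀ v, δ ≤ G.degree v) (hδ : 2 ≤ δ) (hT : ∀ x y z, G.Adj x y → G.Adj y z → ¬ G.Adj z x) :
    2 * δ ≤ #C := by
  obtain ⟨u, hu, u', hu', huw, huw', huu⟩ := h.exists_edge hd hδ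
  have h1 := card_le_card (union_subset (h.neighborFinset_subset hu huw)
    (h.neighborFinset_subset hu' huw'))
  rw [card_union_of_disjoint, SimpleGraph.card_neighborFinset_eq_degree,
    SimpleGraph.card_neighborFinset_eq_degree] at h1
  · have := hd u
    have := hd u'
    omega
  · rw [disjoint_left]
    intro x hx hx'
    rw [SimpleGraph.mem_neighborFinset] at hx hx'
    exact hT _ _ _ huu hx' hx.symm

theorem IsEar.ssubset_addEar {S : Finset V} {p : ℕ → V} {m : ℕ} (h : IsEar G S p m) :
    S ⊂ addEar S p m := by
  have := h.two_le
  refine ⟨subset_union_left, fun h' => ?_⟩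
  exact h.inner 1 (by omega) (by omega) (h' (h.mem_addEar (by omega)))

theorem noShortEar_of_maximal {S : Finset V} {c : V → ZMod 4}
    (hS : Maximal (fun S => Flexible G S c) S) (hc : ∀ u v, G.Adj u v → c v = -c u) :
    NoShortEar G S := by
  intro p m h
  by_contra hm
  have h1 := hS.le_of_ge (hS.prop.addEar h (by omega) fun i hi => hc _ _ (h.adj i hi))
    h.ssubset_addEar.1
  exact h.ssubset_addEar.2 h1

/-- In a bipartite graph of minimum degree at least `|V|/3 ≥ 1` and at least two, the whole vertex
set is flexible. -/
theorem flexible_univ_of_alternating (hG : G.Connected) (hd : ∀ v, δ ≤ G.degree v) (hδ : 2 ≤ δ)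
    (hn : Fintype.card V ≤ 3 * δ) {c : V → ZMod 4} (hc : ∀ u v, G.Adj u v → c v = -c u)
    (hc2 : ∀ v, 2 * c v = 2) : Flexible G univ c := by
  have hunit : ∀ a : ZMod 4, 2 * a = 2 → IsUnit a ∧ a ≠ -a := by decide
  obtain ⟨x⟩ := hG.nonempty
  obtain ⟨S, hxS, hS⟩ := Finite.exists_le_maximal (p := fun S => Flexible G S c)
    (flexible_singleton x (hunit _ (hc2 x)).1)
  have hS' := noShortEar_of_maximal hS hc
  by_cases huniv : S = univ
  · exact huniv ▸ hS.prop
  obtain ⟨y, hy⟩ : ∃ y, y ∉ S := by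
    by_contra! h
    exact huniv (eq_univ_of_forall h)
  obtain ⟨C, w, s, hC, -, -⟩ := hS'.exists_isBridged hG hd hn ⟨x, hxS (mem_singleton_self x)⟩ hy
  have hT : ∀ x y z, G.Adj x y → G.Adj y z → ¬ G.Adj z x := by
    intro x y z hxy hyz hzx
    have h1 := hc _ _ hxy
    have h2 := hc _ _ hyz
    have h3 := hc _ _ hzx
    rw [h2, h1, neg_neg] at h3
    exact (hunit _ (hc2 x)).2 h3
  -- Both sides of the bridge would have at least `2δ` vertices, more than `3δ` in total.
  have h1 := hC.two_mul_le_card hd hδ hT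
  have h2 := hC.compl.two_mul_le_card hd hδ hT
  have h3 := card_add_card_compl C
  omega

/-- Two neighbourhoods of size at least `δ` inside fewer than `2δ` vertices meet, which yields a
triangle. -/
theorem IsBridged.exists_flexible_subset {C : Finset V} {w s : V} (h : IsBridged G C w s)
    (hd : ∀ v, δ ≤ G.degree v) (hC : #C < 2 * δ) {u u' : V} (hu : u ∈ C) (hu' : u' ∈ C)
    (huw : u ≠ w) (huw' : u' ≠ w) (huu : G.Adj u u') :
    ∃ T ⊆ C, u ∈ T ∧ u' ∈ T ∧ 3 ≤ #T ∧ Flexible G T (fun _ => 2) := by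
  have h1 : (G.neighborFinset u ∩ G.neighborFinset u').Nonempty := by
    rw [← card_ne_zero]
    have e1 := card_union_add_card_inter (G.neighborFinset u) (G.neighborFinset u')
    have e2 := card_le_card (union_subset (h.neighborFinset_subset hu huw)
      (h.neighborFinset_subset hu' huw'))
    simp only [SimpleGraph.card_neighborFinset_eq_degree] at e1
    have := hd u
    have := hd u'
    omega
  obtain ⟨z, hz⟩ := h1
  rw [mem_inter] at hz
  have hzC := h.neighborFinset_subset hu huw hz.1
  simp only [SimpleGraph.mem_neighborFinset] at hz
  refine ⟨{u, u', z}, ?_, by simp, by simp, ?_, flexible_triangle huu hz.2 hz.1.symm⟩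
  · simp [insert_subset_iff, hu, hu', hzC]
  · rw [card_eq_three.2 ⟨u, u', z, huu.ne, hz.1.ne, hz.2.ne, rfl⟩]

/-- A maximal flexible `T ⊆ C` containing the triangle on `u`, `u'` must be `C`: otherwise the
degree bounds in the small set `C` produce an ear of length 4 from `u` to `u'`. -/
theorem IsBridged.flexible {C : Finset V} {w s : V} (h : IsBridged G C w s)
    (hd : ∀ v, δ ≤ G.degree v) (hδ : 2 ≤ δ) (hC : #C < 2 * δ) :
    Flexible G C (fun _ => 2) := by
  obtain ⟨u, hu, u', hu', huw, huw', huu⟩ := h.exists_edge hd hδ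
  obtain ⟨T₀, hT₀C, huT, huT', hT₀, hflex⟩ := h.exists_flexible_subset hd hC hu hu' huw huw' huu
  obtain ⟨T, hT₀T, hT⟩ := Finite.exists_le_maximal
    (p := fun T => T ⊆ C ∧ Flexible G T (fun _ => 2)) ⟨hT₀C, hflex⟩
  obtain ⟨hTC, hTflex⟩ := hT.prop
  replace huT := hT₀T huT
  replace huT' := hT₀T huT'
  have hT3 : 3 ≤ #T := hT₀.trans (card_le_card hT₀T)
  have hear : ∀ p m, IsEar G T p m → m ≤ 7 → (∀ i, 0 < i → i < m → p i ∈ C) → False := by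
    intro p m hp hm hpC
    refine hp.ssubset_addEar.2 (hT.le_of_ge ⟨union_subset hTC ?_,
      hTflex.addEar hp hm fun i _ => rfl⟩ hp.ssubset_addEar.1)
    intro x hx
    obtain ⟨i, hi, rfl⟩ := mem_image.1 hx
    rw [mem_Ico] at hi
    exact hpC i hi.1 hi.2
  have hone : ∀ v ∈ C, v ∉ T → ∀ a ∈ T, ∀ b ∈ T, G.Adj v a → G.Adj v b → a = b := by
    intro v hvC hvT a ha b hb hva hvb
    by_contra hab
    refine hear _ _ (isEar_two ha hvT hb hva.symm hvb hab) (by omega) fun i hi hi' => ?_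
    interval_cases i
    simpa [seq]
  have hdeg : ∀ v ∈ C, v ∉ T → δ ≤ #(G.neighborFinset v \ T) + 1 := by
    intro v hvC hvT
    have h1 : #(G.neighborFinset v ∩ T) ≤ 1 := by
      refine card_le_one.2 fun a ha b hb => ?_
      simp only [mem_inter, SimpleGraph.mem_neighborFinset] at ha hb
      exact hone v hvC hvT a ha.2 b hb.2 ha.1 hb.1
    have h2 := card_sdiff_add_card_inter (G.neighborFinset v) T
    have h3 := hd v
    rw [SimpleGraph.card_neighborFinset_eq_degree] at h2
    omega
  by_contra hcon
  obtain ⟨v, hvC, hvT⟩ : ∃ v ∈ C, v ∉ T := by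
    by_contra! h'
    exact hcon (hTC.antisymm h' ▸ hTflex)
  have hcard := card_sdiff_add_card_eq_card hTC
  have hv1 : δ ≤ #(C \ T) + 1 := by
    have h1 : G.neighborFinset v \ T ⊆ insert s ((C \ T).erase v) := by
      intro x hx
      rw [mem_sdiff] at hx
      by_cases hxC : x ∈ C
      · refine mem_insert_of_mem (mem_erase.2 ⟨?_, mem_sdiff.2 ⟨hxC, hx.2⟩⟩)
        rintro rfl
        simp at hx
      · rw [(h.eq_of_adj v hvC x hxC (by simpa using hx.1)).2]
        exact mem_insert_self _ _
    have h2 := card_le_card h1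
    have h3 := card_insert_le s ((C \ T).erase v)
    have h4 := hdeg v hvC hvT
    have h5 : v ∈ C \ T := mem_sdiff.2 ⟨hvC, hvT⟩
    have h6 := card_pos.2 ⟨v, h5⟩
    rw [card_erase_of_mem h5] at h3
    omega
  -- As `3 ≤ #T`, the set `C \ T` has at most `2δ - 4` elements. Being nonempty it forces `δ ≥ 3`,
  -- and `hv1` then gives a second element.
  obtain ⟨y, hy, hyw⟩ := exists_mem_ne (show 1 < #(C \ T) by omega) w
  rw [mem_sdiff] at hy
  have hy1 : δ ≤ #(C \ T) := by
    have h1 : G.neighborFinset y \ T ⊆ (C \ T).erase y := by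
      intro x hx
      rw [mem_sdiff] at hx
      refine mem_erase.2 ⟨?_, mem_sdiff.2 ⟨h.neighborFinset_subset hy.1 hyw hx.1, hx.2⟩⟩
      rintro rfl
      simp at hx
    have h2 := card_le_card h1
    have h4 := hdeg y hy.1 hy.2
    have h5 : y ∈ C \ T := mem_sdiff.2 hy
    have h6 := card_pos.2 ⟨y, h5⟩
    rw [card_erase_of_mem h5] at h2
    omega
  -- From `δ ≤ #(C \ T)` follows `#T < δ`, so a vertex of `T` other than `w` has at least two
  -- neighbours outside `T`, one of them not `w`.
  have hnbr : ∀ u ∈ T, u ≠ w → ∃ y ∈ C, y ∉ T ∧ y ≠ w ∧ G.Adj u y := by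
    intro u huT huw
    have h1 : G.neighborFinset u ∩ T ⊆ T.erase u := by
      intro x hx
      rw [mem_inter] at hx
      refine mem_erase.2 ⟨?_, hx.2⟩
      rintro rfl
      simp at hx
    have h2 := card_le_card h1
    rw [card_erase_of_mem huT] at h2
    have h3 := card_sdiff_add_card_inter (G.neighborFinset u) T
    rw [SimpleGraph.card_neighborFinset_eq_degree] at h3
    have h4 := hd u
    obtain ⟨y, hy, hyw⟩ := exists_mem_ne (show 1 < #(G.neighborFinset u \ T) by omega) w
    rw [mem_sdiff] at hy
    exact ⟨y, h.neighborFinset_subset (hTC huT) huw hy.1, hy.2, hyw, by simpa using hy.1⟩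
  obtain ⟨y₁, hyC₁, hyT₁, hyw₁, huy₁⟩ := hnbr u huT huw
  obtain ⟨y₂, hyC₂, hyT₂, hyw₂, huy₂⟩ := hnbr u' huT' huw'
  have hne : y₁ ≠ y₂ := by
    rintro rfl
    exact huu.ne (hone _ hyC₁ hyT₁ u huT u' huT' huy₁.symm huy₂.symm)
  -- Each set has at least `δ - 1` elements, inside the at most `2δ - 4` elements of `C \ T`.
  have hq : ((G.neighborFinset y₁ \ T) ∩ (G.neighborFinset y₂ \ T)).Nonempty := by
    rw [← card_ne_zero]
    have e1 := card_union_add_card_inter (G.neighborFinset y₁ \ T) (G.neighborFinset y₂ \ T)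
    have e2 := card_le_card (union_subset
      (sdiff_subset_sdiff (h.neighborFinset_subset hyC₁ hyw₁) (subset_refl T))
      (sdiff_subset_sdiff (h.neighborFinset_subset hyC₂ hyw₂) (subset_refl T)))
    have := hdeg _ hyC₁ hyT₁
    have := hdeg _ hyC₂ hyT₂
    omega
  obtain ⟨q, hq⟩ := hq
  simp only [mem_inter, mem_sdiff] at hq
  have hqC := h.neighborFinset_subset hyC₁ hyw₁ hq.1.1
  simp only [SimpleGraph.mem_neighborFinset] at hq
  refine hear _ _ (isEar_four huT hyT₁ hq.1.2 hyT₂ huT' huy₁ hq.1.1 hq.2.1.symm huy₂.symm hne)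
    (by omega) fun i hi hi' => ?_
  interval_cases i <;> simpa [seq]

/-- In a nonbipartite graph other than the pentagon with minimum degree at least `|V|/3` and at
least two, the whole vertex set is flexible. -/
theorem flexible_univ_of_not_isBipartite (hG : G.Connected) (hd : ∀ v, δ ≤ G.degree v)
    (hδ : 2 ≤ δ) (hn : Fintype.card V ≤ 3 * δ) (hbip : ¬ G.IsBipartite)
    (hC5 : ¬ Nonempty (G ≃g SimpleGraph.cycleGraph 5)) : Flexible G univ (fun _ => 2) := by
  obtain ⟨S₀, ⟨x, hx⟩, hflex⟩ := exists_flexible_start hd hδ hn hbip hC5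
  obtain ⟨S, hS₀, hS⟩ := Finite.exists_le_maximal (p := fun S => Flexible G S (fun _ => 2)) hflex
  by_cases huniv : S = univ
  · exact huniv ▸ hS.prop
  obtain ⟨y, hy⟩ : ∃ y, y ∉ S := by
    by_contra! h
    exact huniv (eq_univ_of_forall h)
  obtain ⟨C, w, s, hC, hsS, hCS⟩ := (noShortEar_of_maximal hS fun _ _ _ => rfl).exists_isBridged
    hG hd hn ⟨x, hS₀ hx⟩ hy
  -- The side containing `s` has more than `δ` vertices, which leaves fewer than `2δ` for `C`.
  have h1 := hC.compl.lt_card hd hδ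
  have h2 := card_add_card_compl C
  have h3 := hC.flexible hd hδ (by omega)
  have h4 := hS.le_of_ge (hS.prop.bridge h3 hCS.symm hsS hC.mem hC.adj.symm) subset_union_left
  exact absurd (h4 (mem_union_right _ hC.mem)) (disjoint_left.1 hCS hC.mem)

end

/-! ### Translation to all-roundness -/

section

theorem natCast_finVal (a : ZMod 4) : ((Fin.val (n := 4) a : ℕ) : ZMod 4) = a :=
  ZMod.natCast_zmod_val a

theorem IsConnectedFactorOn.hasConnectedModFourFactor [Nonempty V] {f : V → Fin 4}
    {X : Sym2 V → ZMod 4} (h : IsConnectedFactorOn G univ (fun v => ((f v : ℕ) : ZMod 4)) X) :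
    HasConnectedModFourFactor G f := by
  refine ⟨fun e => X e.1, fun v => ?_, ?_⟩
  · rw [← ZMod.natCast_eq_natCast_iff]
    have h1 := h.sum_eq v (mem_univ v)
    rw [← h1, Nat.cast_sum]
    rw [sum_congr rfl fun e _ => natCast_finVal (X e.1)]
    -- The sum over all of `Sym2 V` reduces to edges of `G` because `X` vanishes elsewhere.
    refine sum_bij_ne_zero (fun e _ _ => e.1) ?_ ?_ ?_ ?_
    · intro e he _
      simpa using he
    · intro e _ _ e' _ _ hee
      exact Subtype.ext hee
    · intro e he hne
      exact ⟨⟨e, h.mem_edgeSet e hne⟩, by simpa using he, hne, rfl⟩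
    · intro e _ _
      rfl
  · have hle : weightGraph X ≤ supportGraph G (fun e => X e.1) := by
      intro u v huv
      rw [weightGraph_adj] at huv
      refine (SimpleGraph.fromEdgeSet_adj _).2 ?_
      exact ⟨⟨h.mem_edgeSet _ huv.1, Fin.pos_iff_ne_zero.2 huv.1⟩, huv.2⟩
    exact ⟨fun u v => (h.reachable u (mem_univ u) v (mem_univ v)).mono hle⟩

theorem isAllRound_of_flexible [Nonempty V] (h : Flexible G univ (fun _ => 2)) :
    IsAllRound G := by
  intro f hf
  obtain ⟨X, hX⟩ := h (fun v => ((f v : ℕ) : ZMod 4)) (by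
    obtain ⟨k, hk⟩ := hf
    have h4 : (4 : ZMod 4) = 0 := rfl
    rw [← mul_sum, ← Nat.cast_sum, hk, Nat.cast_add]
    linear_combination (k : ZMod 4) * h4)
  exact hX.hasConnectedModFourFactor

theorem isBipartiteAllRound_of_flexible [Nonempty V] (hG : G.IsBipartite)
    (h : ∀ c : V → ZMod 4, (∀ u v, G.Adj u v → c v = -c u) → (∀ v, 2 * c v = 2) →
      Flexible G univ c) : IsBipartiteAllRound G := by
  classical
  refine ⟨hG, fun U hU f hf => ?_⟩
  -- For these signs, orthogonality is exactly the congruence of the sums over `U` and its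
  -- complement.
  obtain ⟨X, hX⟩ := h (fun v => if v ∈ U then 1 else -1) (by
    intro u v huv
    rcases hU.mem_of_adj huv with ⟨hu, hv⟩ | ⟨hu, hv⟩ <;>
      simp only [mem_coe, mem_compl] at hu hv <;> simp [hu, hv]) (by
    intro v
    by_cases hv : v ∈ U
    · simp [hv]
    · simp only [if_neg hv]
      decide) (fun v => ((f v : ℕ) : ZMod 4)) (by
    have h1 : ∑ v ∈ U, (if v ∈ U then (1 : ZMod 4) else -1) * ((f v : ℕ) : ZMod 4) =
        ((∑ v ∈ U, (f v : ℕ) : ℕ) : ZMod 4) := by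
      rw [Nat.cast_sum]
      exact sum_congr rfl fun v hv => by rw [if_pos hv, one_mul]
    have h2 : ∑ v ∈ Uᶜ, (if v ∈ U then (1 : ZMod 4) else -1) * ((f v : ℕ) : ZMod 4) =
        -((∑ v ∈ Uᶜ, (f v : ℕ) : ℕ) : ZMod 4) := by
      rw [Nat.cast_sum, ← sum_neg_distrib]
      exact sum_congr rfl fun v hv => by rw [if_neg (mem_compl.1 hv), neg_one_mul]
    rw [← sum_add_sum_compl U, h1, h2, ← sub_eq_add_neg, sub_eq_zero,
      ZMod.natCast_eq_natCast_iff]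
    convert hf)
  exact hX.hasConnectedModFourFactor

theorem allRound_of_minDegree [DecidableRel G.Adj] {δ : ℕ} (hG : G.Connected)
    (hd : ∀ v, δ ≤ G.degree v) (hδ : 2 ≤ δ) (hn : Fintype.card V ≤ 3 * δ)
    (hC5 : ¬ Nonempty (G ≃g SimpleGraph.cycleGraph 5)) :
    (¬ G.IsBipartite → IsAllRound G) ∧ (G.IsBipartite → IsBipartiteAllRound G) :=
  have := hG.nonempty
  ⟨fun h => isAllRound_of_flexible (flexible_univ_of_not_isBipartite hG hd hδ hn h hC5),
    fun h => isBipartiteAllRound_of_flexible h fun _ hc hc2 =>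
      flexible_univ_of_alternating hG hd hδ hn hc hc2⟩

end

end ModFour

theorem mainTheorem12 {V : Type*} [Fintype V] (G : SimpleGraph V) [DecidableRel G.Adj]
    (hG : G.Connected) :
    (3 ≤ Fintype.card V → (Fintype.card V : ℚ) / 2 ≤ (G.minDegree : ℚ) →
      (¬ G.IsBipartite → IsAllRound G) ∧ (G.IsBipartite → IsBipartiteAllRound G)) ∧
    (4 ≤ Fintype.card V → (Fintype.card V : ℚ) / 3 ≤ (G.minDegree : ℚ) →
      ¬ Nonempty (G ≃g SimpleGraph.cycleGraph 5) →
      (¬ G.IsBipartite → IsAllRound G) ∧ (G.IsBipartite → IsBipartiteAllRound G)) := by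
  classical
  refine ⟨fun h3 hδ => ?_, fun h4 hδ hC5 => ?_⟩
  · rw [div_le_iff₀ (by norm_num)] at hδ
    have hδ' : Fintype.card V ≤ G.minDegree * 2 := by exact_mod_cast hδ
    refine ModFour.allRound_of_minDegree hG G.minDegree_le_degree (by omega) (by omega) ?_
    -- The 5-cycle is excluded automatically here: its degree 2 is less than `5/2`.
    rintro ⟨e⟩
    have hcard : Fintype.card V = 5 := by simpa using Fintype.card_congr e.toEquiv
    have h2 : G.degree (e.symm 0) = 2 := by
      rw [← e.degree_eq, e.apply_symm_apply]
      exact SimpleGraph.cycleGraph_degree_three_le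
    have := G.minDegree_le_degree (e.symm 0)
    omega
  · rw [div_le_iff₀ (by norm_num)] at hδ
    have hδ' : Fintype.card V ≤ G.minDegree * 3 := by exact_mod_cast hδ
    exact ModFour.allRound_of_minDegree hG G.minDegree_le_degree (by omega) (by omega) hC5
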